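/- Let $d\ge 1$ be an integer and $\beta\in(0,d]$. For $E\subset\mathbb{R}^d$ let $$\mathcal{H}^\beta_\infty(E)=\inf\Big\{\sum_{i=1}^\infty \omega_\beta r_i^\beta : E\subset\bigcup_{i=1}^\infty B(x_i,r_i)\Big\},\qquad \omega_\beta=\frac{\pi^{\beta/2}}{\Gamma(\beta/2+1)},$$ be the spherical Hausdorff content, and for $f\ge 0$ let $\int_A f\,d\mathcal{H}^\beta_\infty=\int_0^\infty \mathcal{H}^\beta_\infty(\{x\in A: f(x)>t\})\,dt$ be the Choquet integral. Cubes are half-open and may have any orientation; $l(Q)$ denotes the side length of a finite cube $Q$. For a finite or infinite cube $Q_0\subset\mathbb{R}^d$ (an infinite cube is a product, in some orthonormal frame, of half-open intervals of infinite length, for example $\mathbb{R}^d$), let $BMO^\beta(Q_0)$ be the set of functions $u:Q_0\to\mathbb{R}$ such that (i) $u$ is $\mathcal{H}^\beta_\infty$-quasicontinuous: for every $\epsilon>0$ there is an open set $O$ with $\mathcal{H}^\beta_\infty(O)<\epsilon$ such that $u|_{Q_0\setminus O}$ is continuous; (ii) $\int_{Q_0}|u|\,d\mathcal{H}^\beta_\infty<\infty$;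 (iii) $\displaystyle \|u\|_{BMO^\beta(Q_0)}=\sup_{Q\subset Q_0}\inf_{c\in\mathbb{R}}\frac{1}{l(Q)^\beta}\int_Q|u-c|\,d\mathcal{H}^\beta_\infty<\infty$, where the supremum is over all finite subcubes $Q\subset Q_0$ parallel to $Q_0$. **Theorem.** There exist constants $c,C>0$, depending only on $d$ and $\beta$, such that for every cube $Q_0\subset\mathbb{R}^d$, every $u\in BMO^\beta(Q_0)$ and every finite subcube $Q\subset Q_0$ parallel to $Q_0$ there is a number $c_Q\in\mathbb{R}$ with $$\mathcal{H}^\beta_\infty\big(\{x\in Q:|u(x)-c_Q|>t\}\big)\le C\,l(Q)^\beta\exp\!\left(-\frac{ct}{\|u\|_{BMO^\beta(Q_0)}}\right)\qquad\text{for all } t>0,$$ where the right-hand side is understood as $0$ if $\|u\|_{BMO^\beta(Q_0)}=0$. -/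

import Mathlib

open scoped ENNReal NNReal

noncomputable section

namespace JNContent

/-- `ℝ^d` with its Euclidean norm. -/
abbrev Eucl (d : ℕ) : Type := EuclideanSpace ℝ (Fin d)

/-- The normalization constant `ω_β = π^(β/2) / Γ(β/2 + 1)`. -/
def omegaConst (β : ℝ) : ℝ := Real.pi ^ (β / 2) / Real.Gamma (β / 2 + 1)

/-- The `β`-dimensional (spherical) Hausdorff content of a set `A ⊆ ℝ^d`: the infimum of
`∑ i, ω_β * r i ^ β` over all countable coverings of `A` by balls `B (x i) (r i)`. Empty balls,
of radius zero, are allowed, so that finite coverings are included. -/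
def hausdorffContent {d : ℕ} (β : ℝ) (A : Set (Eucl d)) : ℝ≥0∞ :=
  ⨅ (x : ℕ → Eucl d) (r : ℕ → ℝ≥0) (_ : A ⊆ ⋃ i, Metric.ball (x i) (r i : ℝ)),
    ∑' i, ENNReal.ofReal (omegaConst β * (r i : ℝ) ^ β)

/-- The Choquet integral over `A` of a non-negative function `f` with respect to the Hausdorff
content: the Lebesgue integral over `(0, ∞)` of `t ↦ H ({x ∈ A : f x > t})`. -/
def choquetIntegral {d : ℕ} (β : ℝ) (A : Set (Eucl d)) (f : Eucl d → ℝ) : ℝ≥0∞ :=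
  ∫⁻ t in Set.Ioi (0 : ℝ), hausdorffContent β {x | x ∈ A ∧ t < f x}

/-- Quasicontinuity on `A` of (the restriction to `A` of) a function `f` with respect to the
Hausdorff content. -/
def QuasicontinuousOn {d : ℕ} (β : ℝ) (f : Eucl d → ℝ) (A : Set (Eucl d)) : Prop :=
  ∀ ε : ℝ≥0∞, 0 < ε →
    ∃ O : Set (Eucl d), IsOpen O ∧ hausdorffContent β O < ε ∧ ContinuousOn f (A \ O)

/-- The finite (half-open) cube with side length `l`, corner `a` and edges parallel to the vectors
of the orthonormal basis `b`. Two cubes are parallel when they have the same frame `b`. -/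
def cube {d : ℕ} (b : OrthonormalBasis (Fin d) ℝ (Eucl d)) (a : Eucl d) (l : ℝ) :
    Set (Eucl d) :=
  {x | ∀ i, inner ℝ (b i) a ≤ inner ℝ (b i) x ∧ inner ℝ (b i) x < inner ℝ (b i) a + l}

/-- `Q₀` is a cube with edges parallel to the vectors of `b`: either a finite cube, or an infinite
one, a product of (half-open) intervals `[p i, q i)` of infinite length, for example the whole
space. -/
def IsCube {d : ℕ} (b : OrthonormalBasis (Fin d) ℝ (Eucl d)) (Q₀ : Set (Eucl d)) : Prop :=
  (∃ (a : Eucl d) (l : ℝ), 0 < l ∧ Q₀ = cube b a l) ∨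
  (∃ p q : Fin d → EReal, (∀ i, q i - p i = ⊤) ∧
    Q₀ = {x | ∀ i, p i ≤ ((inner ℝ (b i) x : ℝ) : EReal) ∧
      ((inner ℝ (b i) x : ℝ) : EReal) < q i})

/-- The seminorm of `BMO^β(Q₀)`: the supremum over all finite subcubes `Q ⊆ Q₀` parallel to `Q₀`
(that is, with the frame `b`) of `inf_{c ∈ ℝ} l(Q)^(-β) ∫_Q |u - c| dH`. -/
def bmoSeminorm {d : ℕ} (β : ℝ) (b : OrthonormalBasis (Fin d) ℝ (Eucl d)) (Q₀ : Set (Eucl d))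
    (u : Eucl d → ℝ) : ℝ≥0∞ :=
  ⨆ (a : Eucl d) (l : ℝ) (_ : 0 < l) (_ : cube b a l ⊆ Q₀),
    ⨅ c : ℝ, choquetIntegral β (cube b a l) (fun x => |u x - c|) / ENNReal.ofReal (l ^ β)

/-- Membership in `BMO^β(Q₀)`: `u` is quasicontinuous on `Q₀`, has finite Choquet integral
`∫_{Q₀} |u| dH` (these two say `u ∈ L¹(Q₀; H)`), and its seminorm is finite. Only the values of
`u` on `Q₀` matter. -/
structure MemBMO {d : ℕ} (β : ℝ) (b : OrthonormalBasis (Fin d) ℝ (Eucl d)) (Q₀ : Set (Eucl d))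
    (u : Eucl d → ℝ) : Prop where
  quasicontinuous : QuasicontinuousOn β u Q₀
  integral_lt_top : choquetIntegral β Q₀ (fun x => |u x|) < ⊤
  seminorm_lt_top : bmoSeminorm β b Q₀ u < ⊤

/-- The factor `exp (-s / N)` for `s ≥ 0` and `N ∈ [0, ∞]`, as an extended nonnegative real.
For `s > 0` and `N = 0` the quotient is `∞` and the factor is `0`. -/
def expDecay (s : ℝ) (N : ℝ≥0∞) : ℝ≥0∞ :=
  EReal.exp (-((ENNReal.ofReal s / N : ℝ≥0∞) : EReal))

end JNContent

end

open MeasureTheory Set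

namespace JNContent

variable {d : ℕ} {β : ℝ}

/-! ### Elementary properties of the Hausdorff content -/

/-! The content is only subadditive, so averages and a differentiation theorem are replaced by
near-constants and an exact covering. With `N` the seminorm and `τ = 2N/η`, Chebyshev's inequality
gives every subcube `Q` a constant `c_Q` such that `|u - c_Q| ≤ τ` on `Q` off a bad set of content
less than `η l(Q)^β` (`exists_content_lt_of_seminorm_lt`).

The bad set is covered by dyadic cells of small total weight, the weight of a cell being its side to
the power `β`. Replacing these by the maximal cells that they fill up to a fraction `κ` gives
disjoint cells of total weight at most `l(Q)^β / 2`, while the bad set remains sparse in the parent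
of each (`exists_subcubes_cover`). Since a cube has content comparable to `l^β`, the good sets of
`Q` and of the parent share a point, and so do those of the parent and the cell. Hence the constants
of `Q` and the cell differ by at most `4τ`.

Each iteration thus raises the threshold by `4τ` and halves the content bound
(`exists_content_decay`), which is exponential decay. Seminorm zero leaves no scale `τ` and is
treated apart. -/

theorem omegaConst_pos (hβ : 0 < β) : 0 < omegaConst β :=
  div_pos (Real.rpow_pos_of_pos Real.pi_pos _) (Real.Gamma_pos_of_pos (by positivity))

theorem hausdorffContent_le_tsum {A : Set (Eucl d)} (x : ℕ → Eucl d) (r : ℕ → ℝ≥0)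
    (h : A ⊆ ⋃ i, Metric.ball (x i) (r i : ℝ)) :
    hausdorffContent β A ≤ ∑' i, ENNReal.ofReal (omegaConst β * (r i : ℝ) ^ β) :=
  iInf_le_of_le x (iInf_le_of_le r (iInf_le _ h))

/-- The cheapest cost of covering a set by a single ball. -/
noncomputable def ballCost (β : ℝ) (A : Set (Eucl d)) : ℝ≥0∞ :=
  ⨅ (x : Eucl d) (r : ℝ≥0) (_ : A ⊆ Metric.ball x (r : ℝ)),
    ENNReal.ofReal (omegaConst β * (r : ℝ) ^ β)

theorem ballCost_le {A : Set (Eucl d)} {x : Eucl d} {r : ℝ≥0} (h : A ⊆ Metric.ball x (r : ℝ)) :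
    ballCost β A ≤ ENNReal.ofReal (omegaConst β * (r : ℝ) ^ β) :=
  iInf_le_of_le x (iInf_le_of_le r (iInf_le _ h))

theorem exists_ball_of_ballCost_lt {A : Set (Eucl d)} {s : ℝ≥0∞} (h : ballCost β A < s) :
    ∃ (x : Eucl d) (r : ℝ≥0), A ⊆ Metric.ball x (r : ℝ) ∧
      ENNReal.ofReal (omegaConst β * (r : ℝ) ^ β) < s := by
  simp only [ballCost, iInf_lt_iff] at h
  obtain ⟨x, r, hr, h⟩ := h
  exact ⟨x, r, hr, h⟩

theorem exists_cover_of_hausdorffContent_lt {A : Set (Eucl d)} {s : ℝ≥0∞}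
    (h : hausdorffContent β A < s) :
    ∃ (x : ℕ → Eucl d) (r : ℕ → ℝ≥0), A ⊆ ⋃ i, Metric.ball (x i) (r i : ℝ) ∧
      ∑' i, ENNReal.ofReal (omegaConst β * (r i : ℝ) ^ β) < s := by
  simp only [hausdorffContent, iInf_lt_iff] at h
  obtain ⟨x, r, hr, h⟩ := h
  exact ⟨x, r, hr, h⟩

theorem ballCost_empty (hβ : 0 < β) : ballCost β (∅ : Set (Eucl d)) = 0 := by
  refine le_antisymm ((ballCost_le (x := 0) (r := 0) (empty_subset _)).trans ?_) bot_le
  simp [Real.zero_rpow hβ.ne']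

/-- The Hausdorff content as an outer measure. -/
noncomputable def contentMeasure (d : ℕ) {β : ℝ} (hβ : 0 < β) : OuterMeasure (Eucl d) :=
  OuterMeasure.ofFunction (ballCost β) (ballCost_empty hβ)

/-- Covers by arbitrary sets cost no less than covers by balls, up to a summable error. Monotonicity
and countable subadditivity then come from the outer measure. -/
theorem contentMeasure_apply (hβ : 0 < β) (A : Set (Eucl d)) :
    contentMeasure d hβ A = hausdorffContent β A := by
  rw [contentMeasure, OuterMeasure.ofFunction_apply]
  apply le_antisymm
  · refine le_iInf fun x => le_iInf fun r => le_iInf fun h => ?_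
    refine iInf_le_of_le (fun i => Metric.ball (x i) (r i : ℝ)) (iInf_le_of_le h ?_)
    exact ENNReal.tsum_le_tsum fun i => ballCost_le subset_rfl
  · refine le_iInf fun t => le_iInf fun h => ?_
    refine ENNReal.le_of_forall_pos_le_add fun ε hε hfin => ?_
    obtain ⟨ε', hε', hsum⟩ := ENNReal.exists_pos_sum_of_countable
      (ENNReal.coe_ne_zero.2 hε.ne') ℕ
    have hne : ∀ n, ballCost β (t n) ≠ ⊤ := ENNReal.ne_top_of_tsum_ne_top hfin.ne
    choose x r hr hlt using fun n => exists_ball_of_ballCost_lt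
      (ENNReal.lt_add_right (hne n) (ENNReal.coe_ne_zero.2 (hε' n).ne'))
    calc hausdorffContent β A
        ≤ ∑' i, ENNReal.ofReal (omegaConst β * (r i : ℝ) ^ β) :=
          hausdorffContent_le_tsum x r (h.trans (iUnion_mono hr))
      _ ≤ ∑' i, (ballCost β (t i) + ε' i) := ENNReal.tsum_le_tsum fun i => (hlt i).le
      _ = ∑' i, ballCost β (t i) + ∑' i, (ε' i : ℝ≥0∞) := ENNReal.tsum_add
      _ ≤ _ := by gcongr

theorem hausdorffContent_mono (hβ : 0 < β) {A B : Set (Eucl d)} (h : A ⊆ B) :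
    hausdorffContent β A ≤ hausdorffContent β B := by
  rw [← contentMeasure_apply hβ, ← contentMeasure_apply hβ]
  exact measure_mono h

theorem hausdorffContent_iUnion_le (hβ : 0 < β) {ι : Type*} [Countable ι]
    (A : ι → Set (Eucl d)) :
    hausdorffContent β (⋃ i, A i) ≤ ∑' i, hausdorffContent β (A i) := by
  simp_rw [← contentMeasure_apply hβ]
  exact measure_iUnion_le A

theorem hausdorffContent_union_le (hβ : 0 < β) (A B : Set (Eucl d)) :
    hausdorffContent β (A ∪ B) ≤ hausdorffContent β A + hausdorffContent β B := by
  simp_rw [← contentMeasure_apply hβ]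
  exact measure_union_le A B

theorem hausdorffContent_ball_le (hβ : 0 < β) (x : Eucl d) {r : ℝ} (hr : 0 ≤ r) :
    hausdorffContent β (Metric.ball x r) ≤ ENNReal.ofReal (omegaConst β * r ^ β) := by
  lift r to ℝ≥0 using hr
  rw [← contentMeasure_apply hβ]
  exact (OuterMeasure.ofFunction_le _).trans (ballCost_le subset_rfl)

/-- Chebyshev's inequality for the Choquet integral. -/
theorem mul_hausdorffContent_le_choquetIntegral (hβ : 0 < β) (A : Set (Eucl d))
    (f : Eucl d → ℝ) {t : ℝ} :
    ENNReal.ofReal t * hausdorffContent β {x | x ∈ A ∧ t < f x} ≤ choquetIntegral β A f := by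
  calc ENNReal.ofReal t * hausdorffContent β {x | x ∈ A ∧ t < f x}
      = ∫⁻ _ in Ioc (0 : ℝ) t, hausdorffContent β {x | x ∈ A ∧ t < f x} := by
        rw [setLIntegral_const, Real.volume_Ioc, sub_zero, mul_comm]
    _ ≤ ∫⁻ s in Ioc (0 : ℝ) t, hausdorffContent β {x | x ∈ A ∧ s < f x} :=
        setLIntegral_mono' measurableSet_Ioc fun s hs =>
          hausdorffContent_mono hβ fun x hx => ⟨hx.1, hs.2.trans_lt hx.2⟩
    _ ≤ _ := lintegral_mono_set Ioc_subset_Ioi_self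

/-! ### The content of a cube -/

theorem cube_subset_ball (b : OrthonormalBasis (Fin d) ℝ (Eucl d)) (a : Eucl d) {l : ℝ}
    (hl : 0 < l) : cube b a l ⊆ Metric.ball a ((d + 1) * l) := by
  intro x hx
  rw [Metric.mem_ball, dist_eq_norm]
  refine lt_of_pow_lt_pow_left₀ 2 (by positivity) ?_
  rw [← b.sum_sq_norm_inner_right]
  calc ∑ i, ‖inner ℝ (b i) (x - a)‖ ^ 2 ≤ ∑ _i : Fin d, l ^ 2 := by
        refine Finset.sum_le_sum fun i _ => ?_
        rw [inner_sub_right, Real.norm_eq_abs, sq_abs]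
        have := hx i
        exact pow_le_pow_left₀ (by linarith) (by linarith) 2
    _ = d * l ^ 2 := by simp
    _ < ((d + 1) * l) ^ 2 := by
        rw [mul_pow]
        have : (0 : ℝ) ≤ d := Nat.cast_nonneg d
        exact mul_lt_mul_of_pos_right (by nlinarith) (by positivity)

theorem hausdorffContent_cube_le (hβ : 0 < β) (b : OrthonormalBasis (Fin d) ℝ (Eucl d))
    (a : Eucl d) {l : ℝ} (hl : 0 < l) :
    hausdorffContent β (cube b a l) ≤
      ENNReal.ofReal (omegaConst β * (d + 1) ^ β) * ENNReal.ofReal (l ^ β) := by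
  have hω := omegaConst_pos hβ
  refine (hausdorffContent_mono hβ (cube_subset_ball b a hl)).trans
    ((hausdorffContent_ball_le hβ a (by positivity)).trans_eq ?_)
  rw [← ENNReal.ofReal_mul (by positivity), Real.mul_rpow (by positivity) hl.le, mul_assoc]

theorem volume_cube (b : OrthonormalBasis (Fin d) ℝ (Eucl d)) (a : Eucl d) {l : ℝ} (hl : 0 < l) :
    volume (cube b a l) = ENNReal.ofReal (l ^ d) := by
  have hmp := (PiLp.volume_preserving_ofLp (Fin d)).comp b.measurePreserving_repr
  have : cube b a l = (fun x => WithLp.ofLp (b.repr x)) ⁻¹'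
      (univ.pi fun i => Ico (inner ℝ (b i) a) (inner ℝ (b i) a + l)) := by
    ext x
    simp [cube, OrthonormalBasis.repr_apply_apply]
  rw [this]
  refine (hmp.measure_preimage
    (MeasurableSet.univ_pi fun i => measurableSet_Ico).nullMeasurableSet).trans ?_
  rw [Real.volume_pi_Ico]
  simp [ENNReal.ofReal_pow hl.le]

/-- The content of a cube of side length `l` is at least a constant times `l ^ β`. -/
theorem exists_le_hausdorffContent_cube (hβ : 0 < β) (hβd : β ≤ d) :
    ∃ c : ℝ, 0 < c ∧ ∀ (b : OrthonormalBasis (Fin d) ℝ (Eucl d)) (a : Eucl d) (l : ℝ), 0 < l →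
      ENNReal.ofReal (c * l ^ β) ≤ hausdorffContent β (cube b a l) := by
  have hω := omegaConst_pos hβ
  have hd : 0 < d := by exact_mod_cast hβ.trans_le hβd
  have : Nonempty (Fin d) := ⟨⟨0, hd⟩⟩
  set V : ℝ := (volume (Metric.ball (0 : Eucl d) 1)).toReal with hV
  have hVfin : volume (Metric.ball (0 : Eucl d) 1) = ENNReal.ofReal V :=
    (ENNReal.ofReal_toReal measure_ball_lt_top.ne).symm
  have hV0 : 0 ≤ V := ENNReal.toReal_nonneg
  -- The denominator `1 + V` serves both cases: one ball of radius above `l` already costs `ω l^β`,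
  -- and otherwise `r^d ≤ l^(d-β) r^β` turns a comparison of volumes into one of costs.
  refine ⟨omegaConst β / (1 + V), by positivity, fun b a l hl => ?_⟩
  have hlβ : 0 < l ^ β := Real.rpow_pos_of_pos hl β
  refine le_iInf fun x => le_iInf fun r => le_iInf fun h => ?_
  by_cases hbig : ∃ i, l < r i
  · obtain ⟨i, hi⟩ := hbig
    refine le_trans (ENNReal.ofReal_le_ofReal ?_) (ENNReal.le_tsum i)
    have h1 : omegaConst β / (1 + V) ≤ omegaConst β := div_le_self hω.le (by linarith)
    exact mul_le_mul h1 (Real.rpow_le_rpow hl.le hi.le hβ.le) hlβ.le hω.le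
  push Not at hbig
  set T := ∑' i, ENNReal.ofReal (omegaConst β * (r i : ℝ) ^ β) with hT
  have hpow : ∀ i, (r i : ℝ) ^ d * V ≤
      (V * l ^ ((d : ℝ) - β) / omegaConst β) * (omegaConst β * (r i : ℝ) ^ β) := by
    intro i
    have hr : (r i : ℝ) ^ d ≤ l ^ ((d : ℝ) - β) * (r i : ℝ) ^ β := by
      rw [← Real.rpow_natCast]
      calc (r i : ℝ) ^ (d : ℝ) = (r i : ℝ) ^ (((d : ℝ) - β) + β) := by ring_nf
        _ = (r i : ℝ) ^ ((d : ℝ) - β) * (r i : ℝ) ^ β :=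
            Real.rpow_add_of_nonneg (r i).2 (by linarith) hβ.le
        _ ≤ _ := mul_le_mul_of_nonneg_right
            (Real.rpow_le_rpow (r i).2 (hbig i) (by linarith)) (by positivity)
    calc (r i : ℝ) ^ d * V ≤ l ^ ((d : ℝ) - β) * (r i : ℝ) ^ β * V := by gcongr
      _ = _ := by field_simp
  have hvol : ENNReal.ofReal (l ^ d) ≤ ENNReal.ofReal (V * l ^ ((d : ℝ) - β) / omegaConst β) * T :=
    calc ENNReal.ofReal (l ^ d) = volume (cube b a l) := (volume_cube b a hl).symm
      _ ≤ volume (⋃ i, Metric.ball (x i) (r i : ℝ)) := measure_mono h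
      _ ≤ ∑' i, volume (Metric.ball (x i) (r i : ℝ)) := measure_iUnion_le _
      _ ≤ ∑' i, ENNReal.ofReal (V * l ^ ((d : ℝ) - β) / omegaConst β) *
            ENNReal.ofReal (omegaConst β * (r i : ℝ) ^ β) := by
          refine ENNReal.tsum_le_tsum fun i => ?_
          rw [Measure.addHaar_ball volume (x i) (r i).coe_nonneg, hVfin, finrank_euclideanSpace,
            Fintype.card_fin, ← ENNReal.ofReal_mul (by positivity),
            ← ENNReal.ofReal_mul (by positivity)]
          exact ENNReal.ofReal_le_ofReal (hpow i)
      _ = _ := ENNReal.tsum_mul_left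
  by_cases hTtop : T = ⊤
  · rw [hTtop]; exact le_top
  rw [← ENNReal.ofReal_toReal hTtop, ← ENNReal.ofReal_mul (by positivity),
    ENNReal.ofReal_le_ofReal_iff (by positivity)] at hvol
  rw [← ENNReal.ofReal_toReal hTtop]
  refine ENNReal.ofReal_le_ofReal ?_
  have hsplit : l ^ d = l ^ ((d : ℝ) - β) * l ^ β := by
    rw [← Real.rpow_natCast, ← Real.rpow_add hl]; ring_nf
  have hlp : 0 < l ^ ((d : ℝ) - β) := Real.rpow_pos_of_pos hl _
  have hT0 : 0 ≤ T.toReal := ENNReal.toReal_nonneg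
  rw [hsplit, mul_comm V, mul_div_assoc, mul_assoc] at hvol
  have h2 := le_of_mul_le_mul_left hvol hlp
  rw [div_mul_eq_mul_div, div_le_iff₀ (by positivity)]
  rw [div_mul_eq_mul_div, le_div_iff₀ hω] at h2
  nlinarith

/-! ### A stopping-time argument for coverings by cells of nested partitions -/

section Stopping

variable {X ι : Type*} (idx : ℕ → X → ι)

/-- The cell with label `p.2` of the partition of level `p.1`. -/
def cell (p : ℕ × ι) : Set X := {x | idx p.1 x = p.2}

/-- The labels `idx 0, idx 1, …` define finer and finer partitions. -/
def IsRefining : Prop := ∀ j k x y, j ≤ k → idx k x = idx k y → idx j x = idx j y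

/-- The total weight of the members of `R` lying in the cell `p`. -/
noncomputable def packedWeight (w : ℕ → ℝ≥0∞) (R : Set (ℕ × ι)) (p : ℕ × ι) : ℝ≥0∞ :=
  ∑' q : {q | q ∈ R ∧ cell idx q ⊆ cell idx p}, w q.1.1

/-- The cells meeting `Q` that are maximal among the cells of packed weight at least `κ` times
their own weight. -/
def stoppingCells (w : ℕ → ℝ≥0∞) (κ : ℝ≥0∞) (Q : Set X) (R : Set (ℕ × ι)) : Set (ℕ × ι) :=
  {p | ∃ x ∈ Q, idx p.1 x = p.2 ∧ κ * w p.1 ≤ packedWeight idx w R p ∧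
    ∀ j < p.1, packedWeight idx w R (j, idx j x) < κ * w j}

variable {idx} {w : ℕ → ℝ≥0∞} {κ : ℝ≥0∞} {Q : Set X} {R : Set (ℕ × ι)}

theorem IsRefining.cell_subset_cell (h : IsRefining idx) {p q : ℕ × ι} {x : X}
    (hp : x ∈ cell idx p) (hq : x ∈ cell idx q) (hpq : q.1 ≤ p.1) : cell idx p ⊆ cell idx q := by
  intro y hy
  have : idx p.1 y = idx p.1 x := Eq.trans hy (Eq.symm hp)
  exact (h q.1 p.1 y x hpq this).trans hq

theorem le_packedWeight {p : ℕ × ι} (hp : p ∈ R) : w p.1 ≤ packedWeight idx w R p :=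
  ENNReal.le_tsum (f := fun q : {q | q ∈ R ∧ cell idx q ⊆ cell idx p} => w q.1.1)
    ⟨p, hp, subset_rfl⟩

/-- As `κ ≤ 1`, a member of `R` passes the weight test by itself, so there is a first level at which
the cell of `x` passes. -/
theorem exists_stoppingCells_of_mem (hκ : κ ≤ 1) {p : ℕ × ι} (hp : p ∈ R) {x : X} (hxQ : x ∈ Q)
    (hx : x ∈ cell idx p) : ∃ q ∈ stoppingCells idx w κ Q R, x ∈ cell idx q := by
  classical
  have hex : ∃ k, κ * w k ≤ packedWeight idx w R (k, idx k x) := by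
    refine ⟨p.1, ?_⟩
    have : (p.1, idx p.1 x) = p := Prod.ext rfl hx
    rw [this]
    exact (mul_le_of_le_one_left bot_le hκ).trans (le_packedWeight hp)
  refine ⟨(Nat.find hex, idx (Nat.find hex) x), ⟨x, hxQ, rfl, Nat.find_spec hex, fun j hj => ?_⟩,
    rfl⟩
  exact not_le.1 (Nat.find_min hex hj)

/-- Of two stopping cells with a common point, a strictly coarser one would be an ancestor of the
other that passes the test, against maximality. -/
theorem IsRefining.stoppingCells_eq (h : IsRefining idx) {p q : ℕ × ι} {x : X}
    (hp : p ∈ stoppingCells idx w κ Q R) (hq : q ∈ stoppingCells idx w κ Q R)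
    (hxp : x ∈ cell idx p) (hxq : x ∈ cell idx q) : p = q := by
  have key : ∀ p q : ℕ × ι, p ∈ stoppingCells idx w κ Q R → q ∈ stoppingCells idx w κ Q R →
      x ∈ cell idx p → x ∈ cell idx q → ¬ p.1 < q.1 := by
    rintro p q ⟨-, -, -, hp, -⟩ ⟨y, -, hy, -, hmin⟩ hxp hxq hlt
    have hpy : (p.1, idx p.1 y) = p := by
      refine Prod.ext rfl (Eq.trans ?_ hxp)
      exact h _ _ _ _ hlt.le (hy.trans (Eq.symm hxq))
    have := hmin _ hlt
    rw [hpy] at this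
    exact this.not_ge hp
  have h1 : p.1 = q.1 := le_antisymm (not_lt.1 (key q p hq hp hxq hxp))
    (not_lt.1 (key p q hp hq hxp hxq))
  refine Prod.ext h1 ?_
  have hxp' : idx p.1 x = p.2 := hxp
  have hxq' : idx q.1 x = q.2 := hxq
  rw [← hxp', ← hxq', h1]

/-- Stopping cells are disjoint, so a nonempty member of `R` is counted in the packed weight of at
most one of them; exchange the two sums. -/
theorem IsRefining.tsum_stoppingCells_le (h : IsRefining idx)
    (hR : ∀ p ∈ R, (cell idx p).Nonempty) :
    κ * ∑' p : stoppingCells idx w κ Q R, w p.1.1 ≤ ∑' q : R, w q.1.1 := by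
  classical
  rw [← ENNReal.tsum_mul_left]
  calc ∑' p : stoppingCells idx w κ Q R, κ * w p.1.1
      ≤ ∑' p : stoppingCells idx w κ Q R, ∑' q : R,
          if cell idx q.1 ⊆ cell idx p.1 then w q.1.1 else 0 := by
        refine ENNReal.tsum_le_tsum fun p => ?_
        obtain ⟨-, -, -, hp, -⟩ := p.2
        refine hp.trans_eq ?_
        rw [packedWeight, tsum_subtype {q | q ∈ R ∧ cell idx q ⊆ cell idx p.1} (fun q => w q.1),
          tsum_subtype R (fun q => if cell idx q ⊆ cell idx p.1 then w q.1 else 0)]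
        refine tsum_congr fun q => ?_
        by_cases h1 : q ∈ R <;> by_cases h2 : cell idx q ⊆ cell idx p.1 <;>
          simp [indicator, h1, h2]
    _ = ∑' q : R, ∑' p : stoppingCells idx w κ Q R,
          if cell idx q.1 ⊆ cell idx p.1 then w q.1.1 else 0 := ENNReal.tsum_comm
    _ ≤ ∑' q : R, w q.1.1 := by
        refine ENNReal.tsum_le_tsum fun q => ?_
        by_cases hex : ∃ p : stoppingCells idx w κ Q R, cell idx q.1 ⊆ cell idx p.1
        · obtain ⟨p, hp⟩ := hex
          obtain ⟨x, hx⟩ := hR q.1 q.2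
          rw [tsum_eq_single p]
          · simp [hp]
          · intro p' hne
            refine if_neg fun hp' => hne ?_
            exact Subtype.ext (h.stoppingCells_eq p'.2 p.2 (hp' hx) (hp hx))
        · push Not at hex
          rw [ENNReal.tsum_eq_zero.2 fun p => if_neg (hex p)]
          exact bot_le

theorem packedWeight_le (p : ℕ × ι) : packedWeight idx w R p ≤ ∑' q : R, w q.1.1 :=
  ENNReal.tsum_mono_subtype (fun q : ℕ × ι => w q.1) fun _ hq => hq.1

/-- If a cell above a stopping cell meets a covering cell, it contains it. -/
theorem IsRefining.subset_of_mem_of_lt (h : IsRefining idx) (hκ : κ ≤ 1) {p q : ℕ × ι} {x y : X}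
    {j : ℕ} (hp : p ∈ stoppingCells idx w κ Q R) (hx : x ∈ cell idx p) (hj : j < p.1)
    (hq : q ∈ R) (hyq : y ∈ cell idx q) (hy : idx j y = idx j x) :
    cell idx q ⊆ cell idx (j, idx j x) := by
  refine h.cell_subset_cell hyq hy ?_
  -- Otherwise `q` is a proper ancestor of the stopping cell `p`, and as a member of `R` it passes
  -- the test.
  by_contra! hlt
  obtain ⟨z, -, hz, -, hmin⟩ := hp
  have hlt : q.1 < j := hlt
  have hqz : (q.1, idx q.1 z) = q := by
    refine Prod.ext rfl ?_
    calc idx q.1 z = idx q.1 x := h _ _ _ _ (hlt.trans hj).le (hz.trans (Eq.symm hx))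
      _ = idx q.1 y := (h _ _ _ _ hlt.le hy).symm
      _ = q.2 := hyq
  have := hmin q.1 (hlt.trans hj)
  rw [hqz] at this
  exact this.not_ge ((mul_le_of_le_one_left bot_le hκ).trans (le_packedWeight hq))

theorem IsRefining.packedWeight_lt (h : IsRefining idx) {p : ℕ × ι} {x : X}
    {j : ℕ} (hp : p ∈ stoppingCells idx w κ Q R) (hx : x ∈ cell idx p) (hj : j < p.1) :
    packedWeight idx w R (j, idx j x) < κ * w j := by
  obtain ⟨z, -, hz, -, hmin⟩ := hp
  rw [h j p.1 x z hj.le (Eq.trans hx hz.symm)]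
  exact hmin j hj

end Stopping

/-! ### Dyadic cells of a cube -/

section Dyadic

/-- The label of the dyadic cell of level `k` containing `x`, for the dyadic grid generated by the
cube `cube b a l`. -/
noncomputable def dyadicIndex (b : OrthonormalBasis (Fin d) ℝ (Eucl d)) (a : Eucl d) (l : ℝ)
    (k : ℕ) (x : Eucl d) : Fin d → ℤ :=
  fun i => ⌊2 ^ k * ((inner ℝ (b i) x - inner ℝ (b i) a) / l)⌋

/-- The corner of a dyadic cell. -/
noncomputable def dyadicCorner (b : OrthonormalBasis (Fin d) ℝ (Eucl d)) (a : Eucl d) (l : ℝ)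
    (p : ℕ × (Fin d → ℤ)) : Eucl d :=
  a + ∑ i, ((p.2 i : ℝ) * (l / 2 ^ p.1)) • b i

variable {b : OrthonormalBasis (Fin d) ℝ (Eucl d)} {a : Eucl d} {l : ℝ}

theorem isRefining_dyadicIndex : IsRefining (dyadicIndex b a l) := by
  intro j k x y hjk h
  obtain ⟨m, rfl⟩ := Nat.exists_eq_add_of_le hjk
  have key : ∀ z : ℝ, ⌊(2 : ℝ) ^ j * z⌋ = ⌊(2 : ℝ) ^ (j + m) * z⌋ / ((2 ^ m : ℕ) : ℤ) := by
    intro z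
    rw [← Int.floor_div_natCast]
    congr 1
    push_cast
    rw [pow_add]
    field_simp
  funext i
  have hi := congrFun h i
  simp only [dyadicIndex] at hi ⊢
  rw [key, key, hi]

theorem inner_dyadicCorner (p : ℕ × (Fin d → ℤ)) (i : Fin d) :
    inner ℝ (b i) (dyadicCorner b a l p) = inner ℝ (b i) a + p.2 i * (l / 2 ^ p.1) := by
  rw [dyadicCorner, inner_add_right, inner_sum]
  simp [inner_smul_right, b.inner_eq_ite]

theorem cell_dyadicIndex (hl : 0 < l) (p : ℕ × (Fin d → ℤ)) :
    cell (dyadicIndex b a l) p = cube b (dyadicCorner b a l p) (l / 2 ^ p.1) := by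
  ext x
  simp only [cell, cube, mem_ofPred_eq, funext_iff, dyadicIndex, inner_dyadicCorner]
  refine forall_congr' fun i => ?_
  rw [Int.floor_eq_iff]
  have h2 : (0 : ℝ) < 2 ^ p.1 := by positivity
  have e : (2 : ℝ) ^ p.1 * ((inner ℝ (b i) x - inner ℝ (b i) a) / l) =
      (inner ℝ (b i) x - inner ℝ (b i) a) / (l / 2 ^ p.1) := by field_simp
  have hs : 0 < l / 2 ^ p.1 := by positivity
  rw [e, le_div_iff₀ hs, div_lt_iff₀ hs]
  constructor <;> rintro ⟨h1, h2⟩ <;> constructor <;> linarith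

theorem dyadicIndex_zero_eq_zero_iff (hl : 0 < l) {x : Eucl d} :
    dyadicIndex b a l 0 x = 0 ↔ x ∈ cube b a l := by
  have := Set.ext_iff.1 (cell_dyadicIndex (b := b) (a := a) hl (0, 0)) x
  simpa [cell, dyadicCorner] using this

/-- The dyadic cells of a suitable level that meet `E` inside a ball of radius `r` have total
size, measured by the power `β` of the side length, at most a constant times `r ^ β`. -/
theorem exists_level_ball (hβ : 0 < β) (hl : 0 < l) (x : Eucl d) {r : ℝ} (hr : 0 ≤ r)
    {E : Set (Eucl d)} (hE : E ⊆ cube b a l) :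
    ∃ k : ℕ, ∑' p : (fun y => (k, dyadicIndex b a l k y)) '' (E ∩ Metric.ball x r),
        ENNReal.ofReal ((l / 2 ^ p.1.1) ^ β) ≤
      ENNReal.ofReal (3 ^ d * 2 ^ β * r ^ β) := by
  have of_subset : ∀ (k : ℕ) (F : Finset (Fin d → ℤ)), F.card ≤ 3 ^ d → l / 2 ^ k ≤ 2 * r →
      (∀ y ∈ E ∩ Metric.ball x r, dyadicIndex b a l k y ∈ F) →
      ∑' p : (fun y => (k, dyadicIndex b a l k y)) '' (E ∩ Metric.ball x r),
        ENNReal.ofReal ((l / 2 ^ p.1.1) ^ β) ≤ ENNReal.ofReal (3 ^ d * 2 ^ β * r ^ β) := by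
    intro k F hF hk h
    classical
    have hsub : (fun y => (k, dyadicIndex b a l k y)) '' (E ∩ Metric.ball x r) ⊆
        ((F.image fun n => (k, n) : Finset (ℕ × (Fin d → ℤ))) : Set (ℕ × (Fin d → ℤ))) := by
      rintro _ ⟨y, hy, rfl⟩
      simpa using h y hy
    refine (ENNReal.tsum_mono_subtype (fun p : ℕ × (Fin d → ℤ) =>
      ENNReal.ofReal ((l / 2 ^ p.1) ^ β)) hsub).trans ?_
    rw [Finset.tsum_subtype' (F.image fun n => (k, n)) fun p : ℕ × (Fin d → ℤ) =>
      ENNReal.ofReal ((l / 2 ^ p.1) ^ β), Finset.sum_image (by simp)]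
    simp only [Finset.sum_const]
    rw [nsmul_eq_mul, ← ENNReal.ofReal_natCast, ← ENNReal.ofReal_mul (by positivity), mul_assoc,
      ← Real.mul_rpow (by norm_num) hr]
    refine ENNReal.ofReal_le_ofReal (mul_le_mul (by exact_mod_cast hF)
      (Real.rpow_le_rpow (by positivity) hk hβ.le) (by positivity) (by positivity))
  rcases hr.eq_or_lt with rfl | hr
  · exact ⟨0, by simp⟩
  rcases lt_or_ge l r with hlr | hlr
  · refine ⟨0, of_subset 0 {0} (by simpa using Nat.one_le_pow _ _ (by norm_num)) ?_ ?_⟩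
    · simp; linarith
    · intro y hy
      simpa using (dyadicIndex_zero_eq_zero_iff hl).2 (hE hy.1)
  -- The level with `l / 2^(k+1) < r ≤ l / 2^k`: inside the ball each coordinate label differs from
  -- that of the center by at most 1, leaving `3^d` cells of side at most `2r`.
  · obtain ⟨k, hk1, hk2⟩ := exists_nat_pow_near_of_lt_one (div_pos hr hl)
      ((div_le_one hl).2 hlr) (show (0 : ℝ) < 1 / 2 by norm_num) (by norm_num)
    rw [lt_div_iff₀ hl] at hk1
    rw [div_le_iff₀ hl] at hk2
    have hk : l / 2 ^ k = (1 / 2) ^ k * l := by rw [one_div, inv_pow]; field_simp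
    refine ⟨k, of_subset k (Fintype.piFinset fun i =>
      Finset.Icc (dyadicIndex b a l k x i - 1) (dyadicIndex b a l k x i + 1)) ?_ ?_ ?_⟩
    · rw [Fintype.card_piFinset]
      simp only [Int.card_Icc]
      rw [Finset.prod_congr rfl (g := fun _ => 3) (fun i _ => by omega)]
      simp
    · rw [hk]
      rw [pow_succ] at hk1
      linarith
    · intro y hy
      rw [Fintype.mem_piFinset]
      intro i
      have hn : |inner ℝ (b i) y - inner ℝ (b i) x| ≤ r := by
        rw [← inner_sub_right]
        refine (abs_real_inner_le_norm _ _).trans ?_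
        rw [b.norm_eq_one, one_mul, ← dist_eq_norm]
        exact (Metric.mem_ball.1 hy.2).le
      have h3 : |2 ^ k * ((inner ℝ (b i) y - inner ℝ (b i) a) / l) -
          2 ^ k * ((inner ℝ (b i) x - inner ℝ (b i) a) / l)| ≤ 1 := by
        have e : 2 ^ k * ((inner ℝ (b i) y - inner ℝ (b i) a) / l) -
          2 ^ k * ((inner ℝ (b i) x - inner ℝ (b i) a) / l) =
          (inner ℝ (b i) y - inner ℝ (b i) x) / (l / 2 ^ k) := by field_simp; ring
        have hs : 0 < l / 2 ^ k := by positivity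
        rw [e, abs_div, abs_of_pos hs, div_le_one hs, hk]
        linarith
      rw [abs_le] at h3
      simp only [dyadicIndex, Finset.mem_Icc]
      constructor
      · rw [← Int.floor_sub_one]
        exact Int.floor_mono (by linarith)
      · rw [← Int.floor_add_one]
        exact Int.floor_mono (by linarith)

/-- A subset of a cube can be covered by dyadic cells meeting it, with the sum of the powers `β`
of their side lengths controlled by its content. -/
theorem exists_dyadic_cover (hβ : 0 < β) (hl : 0 < l) {E : Set (Eucl d)} (hE : E ⊆ cube b a l)
    {s : ℝ} (h : hausdorffContent β E < ENNReal.ofReal s) :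
    ∃ R : Set (ℕ × (Fin d → ℤ)), (∀ x ∈ E, ∃ p ∈ R, x ∈ cell (dyadicIndex b a l) p) ∧
      (∀ p ∈ R, (cell (dyadicIndex b a l) p).Nonempty) ∧
      ∑' p : R, ENNReal.ofReal ((l / 2 ^ p.1.1) ^ β) ≤
        ENNReal.ofReal (3 ^ d * 2 ^ β / omegaConst β * s) := by
  have hω := omegaConst_pos hβ
  obtain ⟨x, r, hcov, hsum⟩ := exists_cover_of_hausdorffContent_lt h
  choose k hk using fun j => exists_level_ball (b := b) (a := a) hβ hl (x j) (r j).2 hE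
  refine ⟨⋃ j, (fun y => (k j, dyadicIndex b a l (k j) y)) '' (E ∩ Metric.ball (x j) (r j)),
    fun y hy => ?_, ?_, ?_⟩
  · obtain ⟨j, hj⟩ := mem_iUnion.1 (hcov hy)
    exact ⟨_, mem_iUnion.2 ⟨j, y, ⟨hy, hj⟩, rfl⟩, rfl⟩
  · intro p hp
    obtain ⟨j, y, -, rfl⟩ := mem_iUnion.1 hp
    exact ⟨y, rfl⟩
  · refine (ENNReal.tsum_iUnion_le_tsum (fun p : ℕ × (Fin d → ℤ) =>
      ENNReal.ofReal ((l / 2 ^ p.1) ^ β)) _).trans ?_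
    calc _ ≤ ∑' j, ENNReal.ofReal (3 ^ d * 2 ^ β * (r j : ℝ) ^ β) := ENNReal.tsum_le_tsum hk
      _ = ∑' j, ENNReal.ofReal (3 ^ d * 2 ^ β / omegaConst β) *
            ENNReal.ofReal (omegaConst β * (r j : ℝ) ^ β) := by
          refine tsum_congr fun j => ?_
          rw [← ENNReal.ofReal_mul (by positivity)]
          congr 1
          field_simp
      _ ≤ _ := by
          rw [ENNReal.tsum_mul_left, ENNReal.ofReal_mul (by positivity)]
          gcongr

end Dyadic

/-! ### The Calderón–Zygmund type decomposition -/

/-- A subset of a cube of small content is covered by subcubes of small total size, none of which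
is much too large for it: it occupies only a small part of a cube of double side length around
each of them. -/
theorem exists_subcubes_cover (hβ : 0 < β) {γ : ℝ} (hγ : 0 < γ) :
    ∃ η : ℝ, 0 < η ∧ ∀ (b : OrthonormalBasis (Fin d) ℝ (Eucl d)) (a : Eucl d) (l : ℝ), 0 < l →
      ∀ E ⊆ cube b a l, hausdorffContent β E < ENNReal.ofReal (η * l ^ β) →
      ∃ (ι : Type) (_ : Countable ι) (y z : ι → Eucl d) (s : ι → ℝ), (∀ i, 0 < s i) ∧
        E ⊆ ⋃ i, cube b (y i) (s i) ∧
        (∀ i, cube b (y i) (s i) ⊆ cube b (z i) (2 * s i)) ∧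
        (∀ i, cube b (z i) (2 * s i) ⊆ cube b a l) ∧
        (∀ i, hausdorffContent β (E ∩ cube b (z i) (2 * s i)) ≤
          ENNReal.ofReal (γ * (2 * s i) ^ β)) ∧
        ∑' i, ENNReal.ofReal (s i ^ β) ≤ ENNReal.ofReal (l ^ β / 2) := by
  have hω := omegaConst_pos hβ
  set K : ℝ := omegaConst β * (d + 1) ^ β with hK
  have hK0 : 0 < K := by positivity
  set κ : ℝ := min 1 (γ / K) with hκ
  have hκ0 : 0 < κ := lt_min one_pos (by positivity)
  have hκ1 : ENNReal.ofReal κ ≤ 1 := ENNReal.ofReal_le_one.2 (min_le_left _ _)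
  have hκγ : K * κ ≤ γ := by
    have := min_le_right 1 (γ / K)
    rw [← hκ, le_div_iff₀ hK0] at this
    linarith
  set A : ℝ := 3 ^ d * 2 ^ β / omegaConst β with hA
  have hA0 : 0 < A := by positivity
  -- `A` is the loss in passing from balls to dyadic cells, so the cover `R` has total weight at
  -- most `κ l^β / 2`.
  refine ⟨κ / (2 * A), by positivity, fun b a l hl E hE hsmall => ?_⟩
  have hlβ : 0 < l ^ β := Real.rpow_pos_of_pos hl β
  obtain ⟨R, hcov, hne, hsum⟩ := exists_dyadic_cover hβ hl hE hsmall
  have hAη : A * (κ / (2 * A) * l ^ β) = κ * (l ^ β / 2) := by field_simp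
  rw [← hA, hAη] at hsum
  set idx := dyadicIndex b a l with hidx
  have href : IsRefining idx := isRefining_dyadicIndex
  set w : ℕ → ℝ≥0∞ := fun k => ENNReal.ofReal ((l / 2 ^ k) ^ β) with hw
  set S := stoppingCells idx w (ENNReal.ofReal κ) (cube b a l) R with hS
  -- The whole of `R` is too light for a cell of level 0 to pass, so every stopping cell has a
  -- parent inside the cube.
  have hpos : ∀ p ∈ S, 0 < p.1 := by
    rintro p ⟨-, -, -, hp, -⟩
    by_contra! h0
    have h1 := hp.trans ((packedWeight_le p).trans hsum)
    rw [Nat.le_zero.1 h0, hw, ← ENNReal.ofReal_mul hκ0.le,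
      ENNReal.ofReal_le_ofReal_iff (by positivity)] at h1
    have h1 := le_of_mul_le_mul_left h1 hκ0
    simp only [pow_zero, div_one] at h1
    linarith
  have hpt : ∀ p : S, ∃ x ∈ cube b a l, x ∈ cell idx p.1 := by
    rintro ⟨p, x, hx, hxp, -⟩
    exact ⟨x, hx, hxp⟩
  choose x hxQ hx using hpt
  have hside : ∀ p : S, 2 * (l / 2 ^ p.1.1) = l / 2 ^ (p.1.1 - 1) := by
    intro p
    obtain ⟨k, hk⟩ := Nat.exists_eq_add_of_lt (hpos p.1 p.2)
    rw [hk]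
    simp only [zero_add, add_tsub_cancel_right, pow_succ]
    field_simp
  have hparent : ∀ p : S, cell idx (p.1.1 - 1, idx (p.1.1 - 1) (x p)) =
      cube b (dyadicCorner b a l (p.1.1 - 1, idx (p.1.1 - 1) (x p))) (2 * (l / 2 ^ p.1.1)) := by
    intro p
    rw [hside, hidx, cell_dyadicIndex hl]
  refine ⟨S, inferInstance, fun p => dyadicCorner b a l p.1,
    fun p => dyadicCorner b a l (p.1.1 - 1, idx (p.1.1 - 1) (x p)), fun p => l / 2 ^ p.1.1,
    fun p => by positivity, fun y hy => ?_, fun p => ?_, fun p => ?_, fun p => ?_, ?_⟩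
  · obtain ⟨q, hq, hyq⟩ := hcov y hy
    obtain ⟨p, hp, hyp⟩ := exists_stoppingCells_of_mem (w := w) hκ1 hq (hE hy) hyq
    exact mem_iUnion.2 ⟨⟨p, hp⟩, by rwa [← cell_dyadicIndex hl]⟩
  · rw [← hparent, ← cell_dyadicIndex hl]
    exact href.cell_subset_cell (hx p) rfl (Nat.sub_le _ _)
  · rw [← hparent]
    intro y hy
    rw [← dyadicIndex_zero_eq_zero_iff hl] at *
    rw [← (dyadicIndex_zero_eq_zero_iff hl).2 (hxQ p)]
    exact href 0 _ _ _ (Nat.zero_le _) hy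
  -- The parent fails the test, and the members of `R` that meet it lie inside it; they cover this
  -- part of `E` with weight below `κ` times that of the parent.
  · rw [← hparent]
    have hlt : p.1.1 - 1 < p.1.1 := Nat.sub_lt (hpos p.1 p.2) one_pos
    set P := (p.1.1 - 1, idx (p.1.1 - 1) (x p)) with hP
    calc hausdorffContent β (E ∩ cell idx P)
        ≤ hausdorffContent β (⋃ q : {q | q ∈ R ∧ cell idx q ⊆ cell idx P}, cell idx q.1) := by
          refine hausdorffContent_mono hβ fun y hy => ?_
          obtain ⟨q, hq, hyq⟩ := hcov y hy.1
          exact mem_iUnion.2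
            ⟨⟨q, hq, href.subset_of_mem_of_lt hκ1 p.2 (hx p) hlt hq hyq hy.2⟩, hyq⟩
      _ ≤ ∑' q : {q | q ∈ R ∧ cell idx q ⊆ cell idx P}, hausdorffContent β (cell idx q.1) :=
          hausdorffContent_iUnion_le hβ _
      _ ≤ ∑' q : {q | q ∈ R ∧ cell idx q ⊆ cell idx P}, ENNReal.ofReal K * w q.1.1 := by
          refine ENNReal.tsum_le_tsum fun q => ?_
          refine (congrArg (hausdorffContent β) (cell_dyadicIndex hl q.1)).trans_le ?_
          exact hausdorffContent_cube_le hβ b _ (by positivity)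
      _ = ENNReal.ofReal K * packedWeight idx w R P := ENNReal.tsum_mul_left
      _ ≤ ENNReal.ofReal K * (ENNReal.ofReal κ * w (p.1.1 - 1)) := by
          gcongr
          exact (href.packedWeight_lt p.2 (hx p) hlt).le
      _ ≤ _ := by
          rw [← mul_assoc, ← ENNReal.ofReal_mul hK0.le, hw, hside,
            ← ENNReal.ofReal_mul (by positivity)]
          gcongr
  · have h1 := (href.tsum_stoppingCells_le (w := w) (κ := ENNReal.ofReal κ) (Q := cube b a l) hne).trans hsum
    rw [ENNReal.ofReal_mul hκ0.le] at h1
    exact (ENNReal.mul_le_mul_iff_right (by simpa using hκ0) ENNReal.ofReal_ne_top).1 h1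

/-! ### Exponential decay -/

/-- Subadditivity alone supplies a point good for two constants at once, by which they are compared.
-/
theorem exists_mem_notMem_of_content_lt (hβ : 0 < β) {Q A B : Set (Eucl d)}
    (h : hausdorffContent β A + hausdorffContent β B < hausdorffContent β Q) :
    ∃ x ∈ Q, x ∉ A ∧ x ∉ B := by
  by_contra! hcon
  refine h.not_ge ((hausdorffContent_mono hβ fun x hx => ?_).trans
    (hausdorffContent_union_le hβ A B))
  by_cases hA : x ∈ A
  · exact Or.inl hA
  · exact Or.inr (hcon x hx hA)

/-- If on every subcube `u` is within `τ` of a constant outside a set of small relative content,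
then the content of the set where it is farther away decays exponentially. -/
theorem exists_content_decay (hβ : 0 < β) (hβd : β ≤ d) :
    ∃ η : ℝ, 0 < η ∧ ∀ (b : OrthonormalBasis (Fin d) ℝ (Eucl d)) (Q₀ : Set (Eucl d))
      (u : Eucl d → ℝ) (c : Eucl d → ℝ → ℝ) (τ : ℝ), 0 < τ →
      (∀ a l, 0 < l → cube b a l ⊆ Q₀ →
        hausdorffContent β {x | x ∈ cube b a l ∧ τ < |u x - c a l|} <
          ENNReal.ofReal (η * l ^ β)) →
      ∀ (n : ℕ) (a : Eucl d) (l : ℝ), 0 < l → cube b a l ⊆ Q₀ →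
        hausdorffContent β {x | x ∈ cube b a l ∧ τ * (4 * n + 1) < |u x - c a l|} ≤
          ENNReal.ofReal (omegaConst β * (d + 1) ^ β / 2 ^ n) * ENNReal.ofReal (l ^ β) := by
  obtain ⟨c₀, hc₀, hlow⟩ := exists_le_hausdorffContent_cube hβ hβd
  obtain ⟨η, hη, hcov⟩ := exists_subcubes_cover (d := d) hβ (γ := c₀ / 4) (by positivity)
  have hω := omegaConst_pos hβ
  have h2β : (1 : ℝ) ≤ 2 ^ β := Real.one_le_rpow (by norm_num) hβ.le
  -- Two exceptional sets must not fill a cube: in the parent `c₀/4 + η' ≤ c₀`, and in the cell,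
  -- where the bad set of the parent counts with side `2s`, `(2^β + 1) η' ≤ c₀`.
  refine ⟨min η (c₀ / (2 ^ β + 1)), lt_min hη (by positivity),
    fun b Q₀ u c τ hτ hgood n => ?_⟩
  set η' := min η (c₀ / (2 ^ β + 1)) with hη'
  have hη'0 : 0 < η' := lt_min hη (by positivity)
  have hη'c : η' * (2 ^ β + 1) ≤ c₀ := (le_div_iff₀ (by positivity)).1 (min_le_right _ _)
  induction n with
  | zero =>
    intro a l hl _
    simpa using (hausdorffContent_mono hβ fun x hx => hx.1).trans
      (hausdorffContent_cube_le hβ b a hl)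
  | succ n ih =>
    intro a l hl hQ
    have hlβ : 0 < l ^ β := Real.rpow_pos_of_pos hl β
    obtain ⟨ι, _, y, z, s, hs, hE, hyz, hza, hcont, hsum⟩ := hcov b a l hl
      {x | x ∈ cube b a l ∧ τ < |u x - c a l|} (fun x hx => hx.1)
      ((hgood a l hl hQ).trans_le (ENNReal.ofReal_le_ofReal
        (mul_le_mul_of_nonneg_right (min_le_left _ _) hlβ.le)))
    -- Chain through the parent: `v` links the constants of the big cube and the parent, `v'` those
    -- of the parent and the cell, at cost `2τ` each.
    have hclose : ∀ i, |c (y i) (s i) - c a l| ≤ 4 * τ := by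
      intro i
      have hsβ : 0 < s i ^ β := Real.rpow_pos_of_pos (hs i) β
      have hs2 : 0 < 2 * s i := by linarith [hs i]
      have h2sβ : (2 * s i) ^ β = 2 ^ β * s i ^ β := Real.mul_rpow (by norm_num) (hs i).le
      have hgz := hgood (z i) _ hs2 ((hza i).trans hQ)
      have hgy := hgood (y i) _ (hs i) ((hyz i).trans ((hza i).trans hQ))
      obtain ⟨v, hv, hv1, hv2⟩ := exists_mem_notMem_of_content_lt hβ
        (((ENNReal.add_lt_add_of_le_of_lt
          (ne_top_of_le_ne_top ENNReal.ofReal_ne_top (hcont i)) (hcont i) hgz).trans_le (by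
            rw [← ENNReal.ofReal_add (by positivity) (by positivity), ← add_mul]
            refine ENNReal.ofReal_le_ofReal (mul_le_mul_of_nonneg_right ?_ (by positivity))
            nlinarith)).trans_le (hlow b (z i) _ hs2))
      obtain ⟨v', hv', hv'1, hv'2⟩ := exists_mem_notMem_of_content_lt hβ
        ((ENNReal.add_lt_add hgz hgy |>.trans_le (by
            rw [← ENNReal.ofReal_add (by positivity) (by positivity), h2sβ]
            refine ENNReal.ofReal_le_ofReal ?_
            calc η' * (2 ^ β * s i ^ β) + η' * s i ^ β = η' * (2 ^ β + 1) * s i ^ β := by ring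
              _ ≤ c₀ * s i ^ β := by gcongr)).trans_le (hlow b (y i) _ (hs i)))
      have e1 : |u v - c a l| ≤ τ := not_lt.1 fun h => hv1 ⟨⟨hza i hv, h⟩, hv⟩
      have e2 : |u v - c (z i) (2 * s i)| ≤ τ := not_lt.1 fun h => hv2 ⟨hv, h⟩
      have e3 : |u v' - c (z i) (2 * s i)| ≤ τ := not_lt.1 fun h => hv'1 ⟨hyz i hv', h⟩
      have e4 : |u v' - c (y i) (s i)| ≤ τ := not_lt.1 fun h => hv'2 ⟨hv', h⟩
      rw [abs_le] at e1 e2 e3 e4 ⊢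
      constructor <;> linarith
    calc hausdorffContent β {x | x ∈ cube b a l ∧ τ * (4 * (n + 1 : ℕ) + 1) < |u x - c a l|}
        ≤ hausdorffContent β (⋃ i, {x | x ∈ cube b (y i) (s i) ∧
            τ * (4 * n + 1) < |u x - c (y i) (s i)|}) := by
          refine hausdorffContent_mono hβ ?_
          rintro x ⟨hx, hux⟩
          push_cast at hux
          have hn : 0 ≤ τ * n := by positivity
          obtain ⟨i, hi⟩ := mem_iUnion.1 (hE ⟨hx, by linarith⟩)
          refine mem_iUnion.2 ⟨i, hi, ?_⟩
          have := abs_sub_le (u x) (c (y i) (s i)) (c a l)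
          linarith [hclose i]
      _ ≤ ∑' i, hausdorffContent β {x | x ∈ cube b (y i) (s i) ∧
            τ * (4 * n + 1) < |u x - c (y i) (s i)|} := hausdorffContent_iUnion_le hβ _
      _ ≤ ∑' i, ENNReal.ofReal (omegaConst β * (d + 1) ^ β / 2 ^ n) *
            ENNReal.ofReal (s i ^ β) :=
          ENNReal.tsum_le_tsum fun i => ih _ _ (hs i) ((hyz i).trans ((hza i).trans hQ))
      _ ≤ ENNReal.ofReal (omegaConst β * (d + 1) ^ β / 2 ^ n) * ENNReal.ofReal (l ^ β / 2) := by
          rw [ENNReal.tsum_mul_left]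
          gcongr
      _ = _ := by
          rw [← ENNReal.ofReal_mul (by positivity), ← ENNReal.ofReal_mul (by positivity), pow_succ]
          congr 1
          field_simp

/-! ### The John–Nirenberg inequality -/

section BMO

variable {b : OrthonormalBasis (Fin d) ℝ (Eucl d)} {Q₀ : Set (Eucl d)} {u : Eucl d → ℝ}

theorem exists_content_lt_of_seminorm_lt (hβ : 0 < β) {N : ℝ}
    (h : bmoSeminorm β b Q₀ u < ENNReal.ofReal N) {a : Eucl d} {l : ℝ} (hl : 0 < l)
    (hQ : cube b a l ⊆ Q₀) :
    ∃ c : ℝ, ∀ τ s : ℝ, 0 < τ → N ≤ τ * s →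
      hausdorffContent β {x | x ∈ cube b a l ∧ τ < |u x - c|} < ENNReal.ofReal (s * l ^ β) := by
  have hlβ : 0 < l ^ β := Real.rpow_pos_of_pos hl β
  have h1 : ⨅ c : ℝ, choquetIntegral β (cube b a l) (fun x => |u x - c|) /
      ENNReal.ofReal (l ^ β) < ENNReal.ofReal N :=
    lt_of_le_of_lt (le_iSup₂_of_le a l
      (le_iSup₂ (f := fun (_ : 0 < l) (_ : cube b a l ⊆ Q₀) => ⨅ c : ℝ,
        choquetIntegral β (cube b a l) (fun x => |u x - c|) / ENNReal.ofReal (l ^ β)) hl hQ)) h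
  obtain ⟨c, hc⟩ := iInf_lt_iff.1 h1
  refine ⟨c, fun τ s hτ hs => ?_⟩
  by_contra! hcon
  have hN : 0 < N := ENNReal.ofReal_pos.1 (bot_le.trans_lt h)
  have hs0 : 0 < s := pos_of_mul_pos_right (hN.trans_le hs) hτ.le
  refine hc.not_ge ?_
  rw [ENNReal.le_div_iff_mul_le (Or.inl (by simpa using hlβ)) (Or.inl ENNReal.ofReal_ne_top),
    ← ENNReal.ofReal_mul hN.le]
  calc ENNReal.ofReal (N * l ^ β) ≤ ENNReal.ofReal (τ * (s * l ^ β)) := by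
        rw [← mul_assoc]; gcongr
    _ = ENNReal.ofReal τ * ENNReal.ofReal (s * l ^ β) := ENNReal.ofReal_mul hτ.le
    _ ≤ ENNReal.ofReal τ * hausdorffContent β {x | x ∈ cube b a l ∧ τ < |u x - c|} := by gcongr
    _ ≤ _ := mul_hausdorffContent_le_choquetIntegral hβ _ _

/-- A function of seminorm zero is constant on cubes up to sets of content zero. -/
theorem exists_content_eq_zero_of_seminorm_eq_zero (hβ : 0 < β) (hβd : β ≤ d)
    (h : bmoSeminorm β b Q₀ u = 0) {a : Eucl d} {l : ℝ} (hl : 0 < l) (hQ : cube b a l ⊆ Q₀) :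
    ∃ c : ℝ, ∀ t : ℝ, 0 < t →
      hausdorffContent β {x | x ∈ cube b a l ∧ t < |u x - c|} = 0 := by
  obtain ⟨c₀, hc₀, hlow⟩ := exists_le_hausdorffContent_cube hβ hβd
  have hlβ : 0 < l ^ β := Real.rpow_pos_of_pos hl β
  have hsmall : ∀ t s : ℝ, 0 < t → 0 < s → ∃ c : ℝ,
      hausdorffContent β {x | x ∈ cube b a l ∧ t < |u x - c|} < ENNReal.ofReal (s * l ^ β) := by
    intro t s ht hs
    obtain ⟨c, hc⟩ := exists_content_lt_of_seminorm_lt (N := t * s) hβ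
      (by rw [h]; simp; positivity) hl hQ
    exact ⟨c, hc t s ht le_rfl⟩
  let good : ℝ → ℝ → Prop := fun c t => 0 < t ∧
    hausdorffContent β {x | x ∈ cube b a l ∧ t < |u x - c|} < ENNReal.ofReal (c₀ / 2 * l ^ β)
  -- The intervals `[c - t, c + t]` of good pairs meet pairwise, so the supremum of their left
  -- endpoints lies in all of them and is the required constant.
  have hmeet : ∀ c t c' t', good c t → good c' t' → c - t ≤ c' + t' := by
    rintro c t c' t' ⟨-, hc⟩ ⟨-, hc'⟩
    obtain ⟨x, hx, h1, h2⟩ := exists_mem_notMem_of_content_lt hβ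
      ((ENNReal.add_lt_add hc hc').trans_le (by
        rw [← ENNReal.ofReal_add (by positivity) (by positivity), ← add_mul, add_halves]
        exact hlow b a l hl))
    have e1 : |u x - c| ≤ t := not_lt.1 fun h => h1 ⟨hx, h⟩
    have e2 : |u x - c'| ≤ t' := not_lt.1 fun h => h2 ⟨hx, h⟩
    rw [abs_le] at e1 e2
    linarith
  obtain ⟨c₁, hc₁⟩ := hsmall 1 (c₀ / 2) one_pos (by positivity)
  have hgood₁ : good c₁ 1 := ⟨one_pos, hc₁⟩
  let L : Set ℝ := {v | ∃ c t, good c t ∧ v = c - t}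
  have hbdd : BddAbove L := ⟨c₁ + 1, by rintro _ ⟨c, t, hct, rfl⟩; exact hmeet _ _ _ _ hct hgood₁⟩
  have hmem : ∀ c t, good c t → |c - sSup L| ≤ t := by
    intro c t hct
    have h1 : c - t ≤ sSup L := le_csSup hbdd ⟨c, t, hct, rfl⟩
    have h2 : sSup L ≤ c + t := csSup_le ⟨_, c₁, 1, hgood₁, rfl⟩
      (by rintro _ ⟨c', t', hct', rfl⟩; exact hmeet _ _ _ _ hct' hct)
    rw [abs_le]
    constructor <;> linarith
  refine ⟨sSup L, fun t ht => le_antisymm (ENNReal.le_of_forall_pos_le_add fun ε hε _ => ?_) bot_le⟩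
  obtain ⟨c, hc⟩ := hsmall (t / 2) (min (c₀ / 2) (ε / l ^ β)) (by positivity)
    (lt_min (by positivity) (div_pos hε hlβ))
  have hcs := hmem c (t / 2) ⟨by positivity, hc.trans_le (by gcongr; exact min_le_left _ _)⟩
  calc hausdorffContent β {x | x ∈ cube b a l ∧ t < |u x - sSup L|}
      ≤ hausdorffContent β {x | x ∈ cube b a l ∧ t / 2 < |u x - c|} := by
        refine hausdorffContent_mono hβ fun x hx => ⟨hx.1, ?_⟩
        have := abs_sub_le (u x) c (sSup L)
        linarith [hx.2]
    _ ≤ ENNReal.ofReal (min (c₀ / 2) (ε / l ^ β) * l ^ β) := hc.le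
    _ ≤ ENNReal.ofReal ((ε / l ^ β) * l ^ β) := by gcongr; exact min_le_right _ _
    _ = 0 + ε := by rw [div_mul_cancel₀ _ hlβ.ne', ENNReal.ofReal_coe_nnreal, zero_add]

theorem expDecay_ofReal {s N : ℝ} (hs : 0 ≤ s) (hN : 0 < N) :
    expDecay s (ENNReal.ofReal N) = ENNReal.ofReal (Real.exp (-(s / N))) := by
  rw [expDecay, ← ENNReal.ofReal_div_of_pos hN, EReal.coe_ennreal_ofReal,
    max_eq_left (by positivity), ← EReal.coe_neg, EReal.exp_coe]

/-- Rounding down gives `n > t/(4τ) - 5/4`, and the factor 4 absorbs `2^(5/4)`. The alternative `n =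
0` covers `t < τ`, where the trivial bound suffices. -/
theorem exists_nat_inv_two_pow_le {τ : ℝ} (hτ : 0 < τ) (t : ℝ) :
    ∃ n : ℕ, (n = 0 ∨ τ * (4 * n + 1) ≤ t) ∧
      (1 : ℝ) / 2 ^ n ≤ 4 * Real.exp (-(Real.log 2 / 4 * (t / τ))) := by
  refine ⟨⌊(t / τ - 1) / 4⌋₊, ?_, ?_⟩
  · rcases Nat.eq_zero_or_pos ⌊(t / τ - 1) / 4⌋₊ with h0 | h0
    · exact Or.inl h0
    · right
      have h1 := Nat.floor_le (a := (t / τ - 1) / 4) (Nat.pos_of_floor_pos h0).le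
      have h2 : 4 * (⌊(t / τ - 1) / 4⌋₊ : ℝ) + 1 ≤ t / τ := by linarith
      rw [le_div_iff₀ hτ] at h2
      linarith
  · have h1 := Nat.lt_floor_add_one ((t / τ - 1) / 4)
    set n := ⌊(t / τ - 1) / 4⌋₊
    have hlog : 0 < Real.log 2 := Real.log_pos (by norm_num)
    have e1 : (1 : ℝ) / 2 ^ n = Real.exp (-(n * Real.log 2)) := by
      rw [Real.exp_neg, mul_comm, Real.exp_mul, Real.exp_log (by norm_num), Real.rpow_natCast,
        one_div]
    have e2 : (4 : ℝ) = Real.exp (2 * Real.log 2) := by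
      rw [mul_comm, Real.exp_mul, Real.exp_log (by norm_num)]
      norm_num
    rw [e1]
    nth_rw 1 [e2]
    rw [← Real.exp_add]
    refine Real.exp_le_exp.2 ?_
    nlinarith

end BMO

end JNContent

theorem theorem1p3 (d : ℕ) (β : ℝ) (hβ_pos : 0 < β) (hβ_le : β ≤ (d : ℝ)) :
    ∃ c C : ℝ, 0 < c ∧ 0 < C ∧
      ∀ (b : OrthonormalBasis (Fin d) ℝ (JNContent.Eucl d)) (Q₀ : Set (JNContent.Eucl d)),
        JNContent.IsCube b Q₀ →
      ∀ u : JNContent.Eucl d → ℝ, JNContent.MemBMO β b Q₀ u →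
      ∀ (a : JNContent.Eucl d) (l : ℝ), 0 < l → JNContent.cube b a l ⊆ Q₀ →
        ∃ cQ : ℝ, ∀ t : ℝ, 0 < t →
          JNContent.hausdorffContent β {x | x ∈ JNContent.cube b a l ∧ t < |u x - cQ|} ≤
            ENNReal.ofReal (C * l ^ β) *
              JNContent.expDecay (c * t) (JNContent.bmoSeminorm β b Q₀ u) := by
  open JNContent in
  obtain ⟨η, hη, hdecay⟩ := exists_content_decay (d := d) hβ_pos hβ_le
  have hω := omegaConst_pos hβ_pos
  have hlog : 0 < Real.log 2 := Real.log_pos (by norm_num)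
  set K : ℝ := omegaConst β * (d + 1) ^ β with hK
  have hK0 : 0 < K := by positivity
  -- The rate is `log 2 / (4τ)` with `τ = 2N/η`; the 4 in `4 * K` is the rounding loss.
  refine ⟨Real.log 2 / 4 * (η / 2), 4 * K, by positivity, by positivity,
    fun b Q₀ _ u hu a l hl hQ => ?_⟩
  rcases eq_or_ne (bmoSeminorm β b Q₀ u) 0 with h0 | h0
  · obtain ⟨c, hc⟩ := exists_content_eq_zero_of_seminorm_eq_zero hβ_pos hβ_le h0 hl hQ
    exact ⟨c, fun t ht => by rw [hc t ht]; exact bot_le⟩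
  obtain ⟨N, hN, hNeq⟩ : ∃ N : ℝ, 0 < N ∧ bmoSeminorm β b Q₀ u = ENNReal.ofReal N :=
    ⟨_, ENNReal.toReal_pos h0 hu.seminorm_lt_top.ne,
      (ENNReal.ofReal_toReal hu.seminorm_lt_top.ne).symm⟩
  -- The infimum over constants need not be attained, so `N` is doubled to leave room.
  have hlt : bmoSeminorm β b Q₀ u < ENNReal.ofReal (2 * N) := by
    rw [hNeq]
    exact (ENNReal.ofReal_lt_ofReal_iff (by positivity)).2 (by linarith)
  have hex : ∀ (a : Eucl d) (l : ℝ), ∃ c : ℝ, 0 < l → cube b a l ⊆ Q₀ →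
      hausdorffContent β {x | x ∈ cube b a l ∧ 2 * N / η < |u x - c|} <
        ENNReal.ofReal (η * l ^ β) := by
    intro a l
    by_cases h : 0 < l ∧ cube b a l ⊆ Q₀
    · obtain ⟨c, hc⟩ := exists_content_lt_of_seminorm_lt hβ_pos hlt h.1 h.2
      exact ⟨c, fun _ _ => hc _ _ (by positivity) (by rw [div_mul_cancel₀ _ hη.ne'])⟩
    · exact ⟨0, fun h1 h2 => absurd ⟨h1, h2⟩ h⟩
  choose c hc using hex
  refine ⟨c a l, fun t ht => ?_⟩
  obtain ⟨n, hn, hexp⟩ := exists_nat_inv_two_pow_le (τ := 2 * N / η) (by positivity) t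
  have hlβ : 0 < l ^ β := Real.rpow_pos_of_pos hl β
  calc hausdorffContent β {x | x ∈ cube b a l ∧ t < |u x - c a l|}
      ≤ ENNReal.ofReal (K / 2 ^ n) * ENNReal.ofReal (l ^ β) := by
        rcases hn with rfl | hn
        · simpa using (hausdorffContent_mono hβ_pos fun x hx => hx.1).trans
            (hausdorffContent_cube_le hβ_pos b a hl)
        · exact le_trans (hausdorffContent_mono hβ_pos fun x hx => And.intro hx.1 (hn.trans_lt hx.2))
            (hdecay b Q₀ u c (2 * N / η) (by positivity) hc n a l hl hQ)
    _ ≤ _ := by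
        rw [hNeq, expDecay_ofReal (by positivity) hN, ← ENNReal.ofReal_mul (by positivity),
          ← ENNReal.ofReal_mul (by positivity)]
        refine ENNReal.ofReal_le_ofReal ?_
        have e : Real.log 2 / 4 * (η / 2) * t / N = Real.log 2 / 4 * (t / (2 * N / η)) := by
          field_simp
        rw [e]
        calc K / 2 ^ n * l ^ β = K * l ^ β * (1 / 2 ^ n) := by ring
          _ ≤ K * l ^ β * (4 * Real.exp (-(Real.log 2 / 4 * (t / (2 * N / η))))) := by gcongr
          _ = _ := by ring
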